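/- For integers $m\ge 1$ and $0\le i\le m$ let $\beta_{mi}(t)=(m+1)\binom{m}{i}t^i(1-t)^{m-i}$, let $\mathbb{S}_m=\{(p_{m0},\ldots,p_{mm}) : p_{mj}\ge 0,\ \sum_{j=0}^m p_{mj}=1\}$, and let $\Delta_m(t)=\max\{m^{-1},\sqrt{t(1-t)/m}\}$ for $0\le t\le 1$. Let $r\ge 0$ be an integer and $\delta>0$. Let $f$ have a continuous $r$-th derivative on $[0,1]$ (one-sided at the endpoints), with $\int_0^1 f(t)\,dt=1$ and $f(t)\ge\delta$ on $[0,1]$. Then there is a sequence of polynomials $f_m(t)=\sum_{i=0}^m p_{mi}\beta_{mi}(t)$, $m=1,2,\ldots$, with $(p_{m0},\ldots,p_{mm})\in\mathbb{S}_m$, such that $$|f(t)-f_m(t)|\le C\,\Delta_m^{r}(t),\qquad 0\le t\le 1,\quad m\ge 1,$$ where the constant $C$ depends only on $r$, $\delta$, and upper bounds for $\max_t|f(t)|$ and $\max_t|f^{(i)}(t)|$, $i=2,\ldots,r$ (and, in the case $r=1$, for $\max_t|f'(t)|$). In particular $C$ depends neither on $m$ and $t$ nor otherwise on $f$. -/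

import Mathlib

open Set

noncomputable section

/-- The density of the beta distribution with parameters `(i + 1, m - i + 1)`, `0 ≤ i ≤ m`:
`β_{mi}(t) = (m + 1) * (m choose i) * t ^ i * (1 - t) ^ (m - i)`. -/
def betaDensity (m : ℕ) (i : Fin (m + 1)) (t : ℝ) : ℝ :=
  ((m : ℝ) + 1) * (m.choose (i : ℕ) : ℝ) * t ^ (i : ℕ) * (1 - t) ^ (m - (i : ℕ))

/-- The Bernstein type polynomial `f_m(t; p) = ∑_{i=0}^m p_{mi} β_{mi}(t)`. -/
def bernsteinMixture (m : ℕ) (p : Fin (m + 1) → ℝ) (t : ℝ) : ℝ :=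
  ∑ i : Fin (m + 1), p i * betaDensity m i t

/-- `Δ_m(t) = max {1 / m, √(t (1 - t) / m)}`. -/
def bernsteinDelta (m : ℕ) (t : ℝ) : ℝ :=
  max (1 / (m : ℝ)) (Real.sqrt (t * (1 - t) / (m : ℝ)))

end

open Polynomial

/-! Give the Bernstein basis at `k` the coefficient that the Taylor polynomial of `f` at the node
`k/m`, of degree `< r`, would have there (`taylorCoeff`). Had one Taylor polynomial, the one at `t`,
been used for all `k`, the sum at `t` would be exactly `f t`. The error is therefore a difference of
two coefficients, small because the `k`-th coefficient of `(X - k/m)^i` is `O(Δ_m^i)` (a Stein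
recurrence) and the binomial central moments satisfy matching bounds; see
`abs_sub_sum_taylorCoeff_le`.

The linear Taylor term has zero `k`-th coefficient, so each coefficient is `f(k/m) + O(m^{-1/2})`,
positive for large `m` without control of `f'` when `r ≥ 2`. The integral misses 1 by `O(m^{-r/2})`;
a multiple of `(t(1-t))^r` repairs this within `O(Δ_m^r)` (`exists_mixture_of_large`). For bounded
`m`, and for `r = 0`, the uniform weights suffice. -/

/-! ### Bernstein coefficients as linear functionals. -/

/-- The functional on polynomials sending `X ^ l` to `(k choose l) / (m choose l)`. On polynomials of
degree at most `m` it is the `k`-th coefficient in the Bernstein basis of degree `m`. -/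
noncomputable def bernsteinCoeff (m k : ℕ) : ℝ[X] →ₗ[ℝ] ℝ :=
  Polynomial.lsum fun l => ((k.choose l : ℝ) / (m.choose l : ℝ)) • LinearMap.id

theorem bernsteinCoeff_apply (m k : ℕ) (P : ℝ[X]) :
    bernsteinCoeff m k P = P.sum fun l a => (k.choose l : ℝ) / (m.choose l : ℝ) * a := by
  simp [bernsteinCoeff, Polynomial.lsum_apply]

theorem bernsteinCoeff_X_pow (m k l : ℕ) :
    bernsteinCoeff m k (X ^ l) = (k.choose l : ℝ) / (m.choose l : ℝ) := by
  rw [bernsteinCoeff_apply, ← monomial_one_right_eq_X_pow, sum_monomial_index] <;> simp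

theorem bernsteinCoeff_one (m k : ℕ) : bernsteinCoeff m k 1 = 1 := by
  simpa using bernsteinCoeff_X_pow m k 0

theorem bernsteinCoeff_C_mul (m k : ℕ) (c : ℝ) (P : ℝ[X]) :
    bernsteinCoeff m k (C c * P) = c * bernsteinCoeff m k P := by
  rw [← smul_eq_C_mul, map_smul, smul_eq_mul]

theorem bernstein_eval (m k : ℕ) (t : ℝ) :
    (bernsteinPolynomial ℝ m k).eval t = (m.choose k : ℝ) * t ^ k * (1 - t) ^ (m - k) := by
  simp [bernsteinPolynomial]

theorem bernstein_eval_nonneg (m k : ℕ) {t : ℝ} (ht : t ∈ Icc (0 : ℝ) 1) :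
    0 ≤ (bernsteinPolynomial ℝ m k).eval t := by
  rw [bernstein_eval]
  have h1 := ht.1
  have h2 : 0 ≤ 1 - t := by linarith [ht.2]
  positivity

theorem sum_bernstein_eval (m : ℕ) (t : ℝ) :
    ∑ k ∈ Finset.range (m + 1), (bernsteinPolynomial ℝ m k).eval t = 1 := by
  rw [← eval_finsetSum, bernsteinPolynomial.sum, eval_one]

/-- Binomial factorial moments: compare coefficients of `X^l` in `(t(1+X) + (1-t))^m = (1 + tX)^m`.
-/
theorem sum_choose_mul_bernstein_eval (m l : ℕ) (t : ℝ) :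
    ∑ k ∈ Finset.range (m + 1), (k.choose l : ℝ) * (bernsteinPolynomial ℝ m k).eval t =
      (m.choose l : ℝ) * t ^ l := by
  have h : ((C t * (1 + X) + C (1 - t)) ^ m : ℝ[X]) = ((1 + X) ^ m).comp (C t * X) := by
    simp only [pow_comp, add_comp, one_comp, X_comp, map_sub, map_one]
    ring
  have h2 := congrArg (fun P : ℝ[X] => P.coeff l) h
  simp only [comp_C_mul_X_coeff, coeff_one_add_X_pow] at h2
  rw [← h2, add_pow, finsetSum_coeff]
  refine Finset.sum_congr rfl fun k _ => ?_
  have : ((C t * (1 + X)) ^ k * C (1 - t) ^ (m - k) * ((m.choose k : ℕ) : ℝ[X]) : ℝ[X]) =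
      C (t ^ k * (1 - t) ^ (m - k) * (m.choose k : ℝ)) * (1 + X) ^ k := by
    simp only [map_mul, map_pow, map_natCast, mul_pow]
    ring
  rw [this, coeff_C_mul, coeff_one_add_X_pow, bernstein_eval]
  ring

theorem sum_bernsteinCoeff_mul_bernstein_eval {m : ℕ} {P : ℝ[X]} (hP : P.natDegree ≤ m) (t : ℝ) :
    ∑ k ∈ Finset.range (m + 1), bernsteinCoeff m k P * (bernsteinPolynomial ℝ m k).eval t =
      P.eval t := by
  have hk : ∀ k, bernsteinCoeff m k P =
      ∑ l ∈ Finset.range (m + 1), (k.choose l : ℝ) / (m.choose l : ℝ) * P.coeff l := fun k => by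
    rw [bernsteinCoeff_apply, P.sum_over_range' _ (m + 1) (by omega)]
    simp
  simp_rw [hk, Finset.sum_mul]
  rw [Finset.sum_comm, eval_eq_sum_range' (Nat.lt_succ_of_le hP)]
  refine Finset.sum_congr rfl fun l hl => ?_
  have hc : (m.choose l : ℝ) ≠ 0 := by
    have := Nat.choose_pos (Nat.lt_succ_iff.1 (Finset.mem_range.1 hl))
    positivity
  have := sum_choose_mul_bernstein_eval m l t
  calc _ = P.coeff l / (m.choose l : ℝ) * ∑ k ∈ Finset.range (m + 1),
        (k.choose l : ℝ) * (bernsteinPolynomial ℝ m k).eval t := by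
        rw [Finset.mul_sum]
        exact Finset.sum_congr rfl fun k _ => by ring
    _ = _ := by rw [this]; field_simp

theorem abs_bernsteinCoeff_le {m k : ℕ} (hk : k ≤ m) (P : ℝ[X]) :
    |bernsteinCoeff m k P| ≤ ∑ l ∈ P.support, |P.coeff l| := by
  rw [bernsteinCoeff_apply, Polynomial.sum]
  refine (Finset.abs_sum_le_sum_abs _ _).trans (Finset.sum_le_sum fun l _ => ?_)
  rw [abs_mul, abs_of_nonneg (by positivity)]
  refine mul_le_of_le_one_left (abs_nonneg _) (div_le_one_of_le₀ ?_ (by positivity))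
  exact_mod_cast Nat.choose_le_choose l hk

/-- A Stein type identity for the Bernstein coefficients. -/
theorem bernsteinCoeff_stein {m k : ℕ} (hk : k ≤ m) (P : ℝ[X]) :
    bernsteinCoeff m k ((C (m : ℝ) * X - C (k : ℝ)) * P + X * (1 - X) * derivative P) = 0 := by
  induction P using Polynomial.induction_on' with
  | add p q hp hq =>
    rw [← add_zero (0 : ℝ)]
    nth_rewrite 1 [← hp]
    rw [← hq, ← map_add, map_add derivative]
    congr 1
    ring
  | monomial l c =>
    -- On a monomial only the degrees `l + 1` and `l` survive, and the claim becomes the ratio of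
    -- consecutive binomial coefficients.
    have h1 : ((C (m : ℝ) * X - C (k : ℝ)) * monomial l c + X * (1 - X) * derivative (monomial l c)
        : ℝ[X]) = C c * (C ((m : ℝ) - l) * X ^ (l + 1) - C ((k : ℝ) - l) * X ^ l) := by
      rw [← C_mul_X_pow_eq_monomial, derivative_C_mul, derivative_X_pow]
      rcases l with _ | l
      · simp
        ring
      · simp only [Nat.add_sub_cancel, map_sub, map_natCast, Nat.cast_add, Nat.cast_one, map_add,
          map_one]
        ring
    rw [h1, bernsteinCoeff_C_mul, map_sub, bernsteinCoeff_C_mul, bernsteinCoeff_C_mul,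
      bernsteinCoeff_X_pow, bernsteinCoeff_X_pow]
    have e1 : ((k.choose (l + 1) : ℕ) : ℝ) * ((l : ℝ) + 1) = (k.choose l : ℝ) * ((k : ℝ) - l) := by
      rcases le_or_gt l k with h | h
      · have := Nat.choose_succ_right_eq k l
        rw [← Nat.cast_sub h]
        exact_mod_cast this
      · simp [Nat.choose_eq_zero_of_lt h, Nat.choose_eq_zero_of_lt (Nat.lt_succ_of_lt h)]
    have e2 : ((m.choose (l + 1) : ℕ) : ℝ) * ((l : ℝ) + 1) = (m.choose l : ℝ) * ((m : ℝ) - l) := by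
      rcases le_or_gt l m with h | h
      · have := Nat.choose_succ_right_eq m l
        rw [← Nat.cast_sub h]
        exact_mod_cast this
      · simp [Nat.choose_eq_zero_of_lt h, Nat.choose_eq_zero_of_lt (Nat.lt_succ_of_lt h)]
    rw [mul_eq_zero]
    right
    rcases lt_or_ge l m with h | h
    · have c1 : ((m.choose l : ℕ) : ℝ) ≠ 0 := by
        have := Nat.choose_pos h.le
        positivity
      have c2 : ((m.choose (l + 1) : ℕ) : ℝ) ≠ 0 := by
        have := Nat.choose_pos (show l + 1 ≤ m from h)
        positivity
      have c3 : (l : ℝ) + 1 ≠ 0 := by positivity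
      rw [mul_div_assoc', mul_div_assoc', div_sub_div _ _ c2 c1, div_eq_zero_iff]
      left
      apply mul_left_cancel₀ c3
      linear_combination ((m : ℝ) - l) * (m.choose l : ℝ) * e1 -
        ((k : ℝ) - l) * (k.choose l : ℝ) * e2
    -- Here the first quotient has denominator 0, hence value 0; the second vanishes because `k ≤
    -- l`.
    · rw [Nat.choose_eq_zero_of_lt (show m < l + 1 by omega)]
      have : ((k : ℝ) - l) * (k.choose l : ℝ) = 0 := by
        rw [mul_comm, ← e1, Nat.choose_eq_zero_of_lt (show k < l + 1 by omega)]
        simp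
      rw [mul_div_assoc', mul_div_assoc', this]
      simp

/-- Stein's identity for `(X - a)^i`, with `X(1-X)` expanded about `a`. The case `i = 0` kills the
coefficient of `X - a`; the truncated `i - 1` is harmless there because of the factor `i`. -/
theorem bernsteinCoeff_X_sub_C_pow_succ {m k : ℕ} (hk : k ≤ m) {a : ℝ} (ha : (m : ℝ) * a = k)
    (i : ℕ) :
    ((m : ℝ) - i) * bernsteinCoeff m k ((X - C a) ^ (i + 1)) =
      -(i * ((1 - 2 * a) * bernsteinCoeff m k ((X - C a) ^ i) +
        a * (1 - a) * bernsteinCoeff m k ((X - C a) ^ (i - 1)))) := by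
  have h := bernsteinCoeff_stein hk ((X - C a) ^ i)
  have e : ((C (m : ℝ) * X - C (k : ℝ)) * (X - C a) ^ i +
      X * (1 - X) * derivative ((X - C a) ^ i) : ℝ[X]) =
      C ((m : ℝ) - i) * (X - C a) ^ (i + 1) + C (i * (1 - 2 * a)) * (X - C a) ^ i +
        C (i * (a * (1 - a))) * (X - C a) ^ (i - 1) := by
    rw [← ha, derivative_X_sub_C_pow]
    rcases i with _ | i
    · simp
      ring
    · simp only [Nat.add_sub_cancel, map_sub, map_mul, map_natCast, map_one, map_ofNat]
      ring
  rw [e, map_add, map_add, bernsteinCoeff_C_mul, bernsteinCoeff_C_mul, bernsteinCoeff_C_mul] at h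
  linear_combination h

/-! ### The scale `Δ_m` and the coefficients of centred powers. -/

theorem bernsteinDelta_nonneg (m : ℕ) (t : ℝ) : 0 ≤ bernsteinDelta m t :=
  le_max_of_le_right (Real.sqrt_nonneg _)

theorem one_div_le_bernsteinDelta (m : ℕ) (t : ℝ) : 1 / (m : ℝ) ≤ bernsteinDelta m t :=
  le_max_left _ _

theorem div_le_bernsteinDelta_sq {m : ℕ} {t : ℝ} (ht : t ∈ Icc (0 : ℝ) 1) :
    t * (1 - t) / m ≤ bernsteinDelta m t ^ 2 := by
  have h : 0 ≤ t * (1 - t) / m :=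
    div_nonneg (mul_nonneg ht.1 (by linarith [ht.2])) (Nat.cast_nonneg _)
  rw [← Real.sq_sqrt h]
  exact pow_le_pow_left₀ (Real.sqrt_nonneg _) (le_max_right _ _) 2

theorem bernsteinDelta_le {m : ℕ} (hm : 1 ≤ m) {t : ℝ} (ht : t ∈ Icc (0 : ℝ) 1) :
    bernsteinDelta m t ≤ 1 / Real.sqrt m := by
  have hm' : (1 : ℝ) ≤ m := by exact_mod_cast hm
  have hs : 1 / Real.sqrt m = Real.sqrt (1 / m) := by
    rw [Real.sqrt_div zero_le_one, Real.sqrt_one]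
  refine max_le ?_ ?_
  · gcongr
    exact Real.sqrt_le_self_iff.2 (Or.inr hm')
  · rw [hs]
    apply Real.sqrt_le_sqrt
    gcongr
    nlinarith [ht.1, ht.2]

/-- Lets `Δ_m` at a node be replaced by `Δ_m` at `t`. By concavity `x(1-x) ≤ t(1-t) + |x-t|`, and
`1/m ≤ Δ_m(t)` absorbs the division by `m`. -/
theorem bernsteinDelta_le_add (m : ℕ) {t : ℝ} (ht : t ∈ Icc (0 : ℝ) 1) (x : ℝ) :
    bernsteinDelta m x ≤ bernsteinDelta m t + |x - t| := by
  have hd := bernsteinDelta_nonneg m t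
  have ha := abs_nonneg (x - t)
  refine max_le ((one_div_le_bernsteinDelta m t).trans (by linarith)) ?_
  apply Real.sqrt_le_iff.2 ⟨by positivity, ?_⟩
  have h1 : x * (1 - x) ≤ t * (1 - t) + |x - t| := by
    rcases abs_cases (x - t) with ⟨h, h'⟩ | ⟨h, h'⟩ <;> rw [h] <;>
      nlinarith [ht.1, ht.2]
  calc x * (1 - x) / m ≤ (t * (1 - t) + |x - t|) / m := by gcongr
    _ = t * (1 - t) / m + |x - t| * (1 / m) := by ring
    _ ≤ bernsteinDelta m t ^ 2 + |x - t| * bernsteinDelta m t := by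
        gcongr
        · exact div_le_bernsteinDelta_sq ht
        · exact one_div_le_bernsteinDelta m t
    _ ≤ _ := by nlinarith

/-- Induction along the recurrence: `m - i ≥ m/2`, and the factors `1/m ≤ D` and `a(1-a)/m ≤ D^2`
pay for one and two missing degrees. Two terms with factor `2r` each give `4r`. -/
theorem abs_bernsteinCoeff_X_sub_C_pow_le {m k r : ℕ} (hr : 1 ≤ r) (hm : 2 * r ≤ m) (hk : k ≤ m)
    {i : ℕ} (hi : i ≤ r) :
    |bernsteinCoeff m k ((X - C ((k : ℝ) / m)) ^ i)| ≤
      (4 * r : ℝ) ^ i * bernsteinDelta m ((k : ℝ) / m) ^ i := by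
  have hm0 : (0 : ℝ) < m := by exact_mod_cast (by omega : 0 < m)
  set a : ℝ := (k : ℝ) / m with ha
  have ha' : (m : ℝ) * a = k := by rw [ha]; field_simp
  have haI : a ∈ Icc (0 : ℝ) 1 :=
    ⟨by positivity, div_le_one_of_le₀ (by exact_mod_cast hk) hm0.le⟩
  set D := bernsteinDelta m a with hD
  have hD0 : 0 ≤ D := bernsteinDelta_nonneg m a
  have hD1 : 1 / (m : ℝ) ≤ D := one_div_le_bernsteinDelta m a
  have hD2 : a * (1 - a) / m ≤ D ^ 2 := div_le_bernsteinDelta_sq haI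
  have hr' : (1 : ℝ) ≤ r := by exact_mod_cast hr
  induction i using Nat.strong_induction_on with
  | _ i ih =>
    rcases i with _ | i
    · simp [bernsteinCoeff_one]
    · have hrec := bernsteinCoeff_X_sub_C_pow_succ hk ha' i
      rcases Nat.eq_zero_or_pos i with rfl | hipos
      · have : bernsteinCoeff m k ((X - C a) ^ (0 + 1)) = 0 := by
          simpa [hm0.ne'] using hrec
        rw [this, abs_zero]
        positivity
      · have h1 := ih i (by omega) (by omega)
        have h2 := ih (i - 1) (by omega) (by omega)
        set u := bernsteinCoeff m k ((X - C a) ^ (i + 1))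
        set v := bernsteinCoeff m k ((X - C a) ^ i)
        set w := bernsteinCoeff m k ((X - C a) ^ (i - 1))
        have hir : (i : ℝ) ≤ r := by exact_mod_cast (by omega : i ≤ r)
        have hmr : 2 * (r : ℝ) ≤ m := by exact_mod_cast hm
        have hX : 0 ≤ a * (1 - a) := mul_nonneg haI.1 (by linarith [haI.2])
        have h3 : ((m : ℝ) - i) * |u| ≤ i * (|v| + a * (1 - a) * |w|) := by
          calc ((m : ℝ) - i) * |u| = |((m : ℝ) - i) * u| := by
                rw [abs_mul, abs_of_nonneg (by linarith : (0 : ℝ) ≤ m - i)]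
            _ = i * |(1 - 2 * a) * v + a * (1 - a) * w| := by
                rw [hrec, abs_neg, abs_mul, abs_of_nonneg (by positivity)]
            _ ≤ i * (|v| + a * (1 - a) * |w|) := by
                gcongr
                refine (abs_add_le _ _).trans ?_
                rw [abs_mul, abs_mul, abs_of_nonneg hX]
                gcongr
                refine mul_le_of_le_one_left (abs_nonneg _) (abs_le.2 ⟨?_, ?_⟩) <;>
                  linarith [haI.1, haI.2]
        have h4 : |u| ≤ 2 * r * (|v| * (1 / m) + a * (1 - a) / m * |w|) := by
          have h5 : (m : ℝ) / 2 * |u| ≤ r * (|v| + a * (1 - a) * |w|) := by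
            refine le_trans ?_ (h3.trans ?_)
            · gcongr
              linarith
            · gcongr
          have h6 : 2 * r * (|v| * (1 / m) + a * (1 - a) / m * |w|) =
              2 / m * (r * (|v| + a * (1 - a) * |w|)) := by
            field_simp
          rw [h6]
          calc |u| = 2 / m * (m / 2 * |u|) := by field_simp
            _ ≤ _ := by gcongr
        have hb : (1 : ℝ) ≤ 4 * r := by linarith
        calc |u| ≤ 2 * r * (|v| * (1 / m) + a * (1 - a) / m * |w|) := h4
          _ ≤ 2 * r * (((4 * r : ℝ) ^ i * D ^ i) * D +
                D ^ 2 * ((4 * r : ℝ) ^ i * D ^ (i - 1))) := by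
              gcongr
              refine h2.trans ?_
              gcongr
              omega
          _ = (4 * r : ℝ) ^ (i + 1) * D ^ (i + 1) := by
              obtain ⟨j, rfl⟩ : ∃ j, i = j + 1 := ⟨i - 1, by omega⟩
              rw [Nat.add_sub_cancel]
              ring

/-! ### Exponential and absolute central moments of the binomial law. -/

theorem sum_bernstein_mul_exp_le (m : ℕ) {t c : ℝ} (ht : t ∈ Icc (0 : ℝ) 1) (hc : |c| ≤ 1) :
    ∑ k ∈ Finset.range (m + 1), (bernsteinPolynomial ℝ m k).eval t *
      Real.exp (c * ((k : ℝ) - m * t)) ≤ Real.exp (m * (c ^ 2 * (t * (1 - t)))) := by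
  have h0 := ht.1
  have h1 : 0 ≤ 1 - t := by linarith [ht.2]
  -- Applied to both outcomes of a single centred Bernoulli trial, where the linear terms cancel.
  have hexp : ∀ u : ℝ, |u| ≤ 1 → Real.exp u ≤ 1 + u + u ^ 2 := fun u hu => by
    linarith [(abs_le.1 (Real.abs_exp_sub_one_sub_id_le hu)).2]
  have e : ∑ k ∈ Finset.range (m + 1), (bernsteinPolynomial ℝ m k).eval t *
      Real.exp (c * ((k : ℝ) - m * t)) =
      (t * Real.exp (c * (1 - t)) + (1 - t) * Real.exp (-(c * t))) ^ m := by
    rw [add_pow]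
    refine Finset.sum_congr rfl fun k hk => ?_
    have hkm : k ≤ m := Nat.lt_succ_iff.1 (Finset.mem_range.1 hk)
    rw [bernstein_eval, mul_pow, mul_pow, ← Real.exp_nat_mul, ← Real.exp_nat_mul,
      Nat.cast_sub hkm]
    have : c * ((k : ℝ) - m * t) = k * (c * (1 - t)) + ((m : ℝ) - k) * -(c * t) := by ring
    rw [this, Real.exp_add]
    ring
  rw [e, Real.exp_nat_mul]
  apply pow_le_pow_left₀ (by positivity)
  have b1 := hexp (c * (1 - t)) (by
    rw [abs_mul, abs_of_nonneg h1]
    exact mul_le_one₀ hc h1 (by linarith))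
  have b2 := hexp (-(c * t)) (by
    rw [abs_neg, abs_mul, abs_of_nonneg h0]
    exact mul_le_one₀ hc h0 ht.2)
  calc _ ≤ t * (1 + c * (1 - t) + (c * (1 - t)) ^ 2) +
        (1 - t) * (1 + -(c * t) + (-(c * t)) ^ 2) := by gcongr
    _ = c ^ 2 * (t * (1 - t)) + 1 := by ring
    _ ≤ _ := Real.add_one_le_exp _

theorem sum_bernstein_mul_abs_sub_pow_le {m : ℕ} (hm : 1 ≤ m) {t : ℝ} (ht : t ∈ Icc (0 : ℝ) 1)
    (n : ℕ) :
    ∑ k ∈ Finset.range (m + 1), (bernsteinPolynomial ℝ m k).eval t * |(k : ℝ) / m - t| ^ n ≤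
      2 * Real.exp 1 * n.factorial * bernsteinDelta m t ^ n := by
  have hm0 : (0 : ℝ) < m := by exact_mod_cast hm
  set d := bernsteinDelta m t with hd
  have hd1 : 1 / (m : ℝ) ≤ d := one_div_le_bernsteinDelta m t
  have hd0 : 0 < d := lt_of_lt_of_le (by positivity) hd1
  have hd2 : t * (1 - t) / m ≤ d ^ 2 := div_le_bernsteinDelta_sq ht
  -- This `c` makes the exponent `t(1-t)/(m d^2) ≤ 1`, while `d ≥ 1/m` keeps `c ≤ 1`.
  set c : ℝ := 1 / (m * d) with hc
  have hc0 : 0 ≤ c := by positivity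
  have hc1 : c ≤ 1 := by
    rw [hc, div_le_one (by positivity)]
    rwa [div_le_iff₀' hm0] at hd1
  have hexp : Real.exp (m * (c ^ 2 * (t * (1 - t)))) ≤ Real.exp 1 := by
    apply Real.exp_le_exp.2
    have : m * (c ^ 2 * (t * (1 - t))) = (t * (1 - t) / m) / d ^ 2 := by
      rw [hc]
      field_simp
    rw [this]
    exact div_le_one_of_le₀ hd2 (by positivity)
  have hp := (sum_bernstein_mul_exp_le m ht (by rwa [abs_of_nonneg hc0])).trans hexp
  have hn := sum_bernstein_mul_exp_le m (c := -c) ht (by rwa [abs_neg, abs_of_nonneg hc0])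
  rw [neg_sq] at hn
  replace hn := hn.trans hexp
  calc _ ≤ ∑ k ∈ Finset.range (m + 1), (n.factorial * d ^ n) *
        ((bernsteinPolynomial ℝ m k).eval t * Real.exp (c * ((k : ℝ) - m * t)) +
          (bernsteinPolynomial ℝ m k).eval t * Real.exp (-c * ((k : ℝ) - m * t))) := by
        refine Finset.sum_le_sum fun k _ => ?_
        have hb := bernstein_eval_nonneg m k ht
        set y := c * ((k : ℝ) - m * t) with hy
        have hyd : |(k : ℝ) / m - t| = d * |y| := by
          have : (k : ℝ) / m - t = d * y := by
            rw [hy, hc]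
            field_simp
          rw [this, abs_mul, abs_of_pos hd0]
        have h1 : |y| ^ n ≤ n.factorial * (Real.exp y + Real.exp (-y)) := by
          have := Real.pow_div_factorial_le_exp |y| (abs_nonneg y) n
          rw [div_le_iff₀' (by positivity)] at this
          refine this.trans ?_
          gcongr
          rcases abs_cases y with ⟨h, _⟩ | ⟨h, _⟩ <;> rw [h] <;>
            linarith [Real.exp_pos y, Real.exp_pos (-y)]
        rw [hyd, mul_pow, neg_mul, ← hy]
        calc _ ≤ (bernsteinPolynomial ℝ m k).eval t *
              (d ^ n * (n.factorial * (Real.exp y + Real.exp (-y)))) := by gcongr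
          _ = _ := by ring
    _ ≤ (n.factorial * d ^ n) * (Real.exp 1 + Real.exp 1) := by
        rw [← Finset.mul_sum, Finset.sum_add_distrib]
        gcongr
    _ = _ := by ring

/-! ### Integrals of Bernstein polynomials. -/

theorem integral_bernstein {m k : ℕ} (hk : k ≤ m) :
    ∫ t in (0 : ℝ)..1, (bernsteinPolynomial ℝ m k).eval t = 1 / ((m : ℝ) + 1) := by
  -- Integrating the derivative of the `(k+1)`-st polynomial of degree `m + 1` shows that
  -- consecutive integrals agree until `k = m`, where the descending induction starts.
  have key : ∀ k, ((m : ℝ) + 1) * ((∫ t in (0 : ℝ)..1, (bernsteinPolynomial ℝ m k).eval t) -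
      ∫ t in (0 : ℝ)..1, (bernsteinPolynomial ℝ m (k + 1)).eval t) =
      if k = m then 1 else 0 := fun k => by
    have h := intervalIntegral.integral_eq_sub_of_hasDerivAt
      (f := fun t => (bernsteinPolynomial ℝ (m + 1) (k + 1)).eval t) (a := 0) (b := 1)
      (fun t _ => Polynomial.hasDerivAt _ t)
      ((Polynomial.continuous _).intervalIntegrable _ _)
    rw [bernsteinPolynomial.eval_at_0, bernsteinPolynomial.eval_at_1,
      bernsteinPolynomial.derivative_succ] at h
    rw [← intervalIntegral.integral_sub ((Polynomial.continuous _).intervalIntegrable _ _)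
      ((Polynomial.continuous _).intervalIntegrable _ _), ← intervalIntegral.integral_const_mul]
    simpa using h
  have hm : (m : ℝ) + 1 ≠ 0 := by positivity
  induction hk using Nat.decreasingInduction with
  | self =>
    have := key m
    rw [bernsteinPolynomial.eq_zero_of_lt ℝ (Nat.lt_succ_self m)] at this
    simp only [eval_zero, intervalIntegral.integral_zero, sub_zero, if_true] at this
    rw [eq_div_iff hm, mul_comm, this]
  | of_succ j hj ih =>
    have := key j
    rw [if_neg (by omega), ih] at this
    rcases mul_eq_zero.1 this with h | h
    · exact absurd h hm
    · linarith

theorem integral_sum_mul_bernstein {m : ℕ} (a : ℕ → ℝ) :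
    ∫ t in (0 : ℝ)..1, ∑ k ∈ Finset.range (m + 1), a k * (bernsteinPolynomial ℝ m k).eval t =
      (∑ k ∈ Finset.range (m + 1), a k) / ((m : ℝ) + 1) := by
  rw [intervalIntegral.integral_finsetSum, Finset.sum_div]
  · refine Finset.sum_congr rfl fun k hk => ?_
    rw [intervalIntegral.integral_const_mul,
      integral_bernstein (Nat.lt_succ_iff.1 (Finset.mem_range.1 hk))]
    ring
  · intro k _
    exact (continuous_const.mul (Polynomial.continuous _)).intervalIntegrable _ _

/-! ### Taylor polynomials on the unit interval. -/

/-- The Taylor polynomial at `t` of degree less than `r` of a function on `[0, 1]`. -/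
noncomputable def unitTaylor (f : ℝ → ℝ) (r : ℕ) (t : ℝ) : ℝ[X] :=
  ∑ i ∈ Finset.range r,
    C (iteratedDerivWithin i f (Icc 0 1) t / i.factorial) * (X - C t) ^ i

theorem natDegree_unitTaylor_lt {r : ℕ} (hr : 1 ≤ r) (f : ℝ → ℝ) (t : ℝ) :
    (unitTaylor f r t).natDegree < r := by
  refine Nat.lt_of_le_pred hr (natDegree_sum_le_of_forall_le _ _ fun i hi => ?_)
  refine (natDegree_C_mul_le _ _).trans ?_
  rw [natDegree_pow, natDegree_X_sub_C, mul_one]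
  exact Nat.le_pred_of_lt (Finset.mem_range.1 hi)

theorem iterate_derivative_eval_eq (P : ℝ[X]) (i : ℕ) (t : ℝ) :
    (derivative^[i] P).eval t = i.factorial * (taylor t P).coeff i := by
  rw [taylor_coeff, ← factorial_smul_hasseDeriv]
  simp

theorem iterate_derivative_unitTaylor_eval {r i : ℕ} (hi : i < r) (f : ℝ → ℝ) (t : ℝ) :
    (derivative^[i] (unitTaylor f r t)).eval t = iteratedDerivWithin i f (Icc 0 1) t := by
  have h : taylor t (unitTaylor f r t) = ∑ j ∈ Finset.range r,
      C (iteratedDerivWithin j f (Icc 0 1) t / j.factorial) * X ^ j := by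
    simp [unitTaylor, map_sum, taylor_mul, taylor_pow]
  rw [iterate_derivative_eval_eq, h, finsetSum_coeff]
  simp only [coeff_C_mul_X_pow]
  rw [Finset.sum_ite_eq, if_pos (Finset.mem_range.2 hi)]
  field_simp

/-- Descending induction on `i`: at `i = r` the polynomial contributes 0, and each step down applies
the mean value inequality from `t`, where the difference vanishes. -/
theorem abs_iteratedDerivWithin_sub_unitTaylor_le {r : ℕ} (hr : 1 ≤ r) {f : ℝ → ℝ} {M : ℝ}
    (hf : ContDiffOn ℝ (r : ℕ∞) f (Icc 0 1))
    (hM : ∀ x ∈ Icc (0 : ℝ) 1, |iteratedDerivWithin r f (Icc 0 1) x| ≤ M)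
    {t : ℝ} (ht : t ∈ Icc (0 : ℝ) 1) {i : ℕ} (hi : i ≤ r) :
    ∀ x ∈ Icc (0 : ℝ) 1, |iteratedDerivWithin i f (Icc 0 1) x -
      (derivative^[i] (unitTaylor f r t)).eval x| ≤ M * |x - t| ^ (r - i) := by
  induction hi using Nat.decreasingInduction with
  | self =>
    intro x hx
    rw [iterate_derivative_eq_zero (natDegree_unitTaylor_lt hr f t)]
    simpa using hM x hx
  | of_succ i hi ih =>
    intro x hx
    have hM0 : 0 ≤ M := (abs_nonneg _).trans (hM t ht)
    have hsub : uIcc t x ⊆ Icc (0 : ℝ) 1 := uIcc_subset_Icc ht hx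
    have hd : ∀ y ∈ uIcc t x, HasDerivWithinAt (fun y => iteratedDerivWithin i f (Icc 0 1) y -
        (derivative^[i] (unitTaylor f r t)).eval y)
        (iteratedDerivWithin (i + 1) f (Icc 0 1) y -
          (derivative^[i + 1] (unitTaylor f r t)).eval y) (uIcc t x) y := fun y hy => by
      refine HasDerivWithinAt.sub ?_ ?_
      · have h := (hf.differentiableOn_iteratedDerivWithin (m := i) (by exact_mod_cast hi)
          (uniqueDiffOn_Icc zero_lt_one) y (hsub hy)).hasDerivWithinAt
        rw [← iteratedDerivWithin_succ] at h
        exact h.mono hsub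
      · rw [Function.iterate_succ_apply']
        exact (Polynomial.hasDerivAt _ y).hasDerivWithinAt
    have hb := (convex_uIcc t x).norm_image_sub_le_of_norm_hasDerivWithin_le hd
      (C := M * |x - t| ^ (r - (i + 1))) (fun y hy => by
        refine (ih y (hsub hy)).trans ?_
        gcongr ?_ * ?_ ^ _
        exact abs_sub_left_of_mem_uIcc hy) left_mem_uIcc right_mem_uIcc
    rw [iterate_derivative_unitTaylor_eval (by omega), sub_self, sub_zero, mul_assoc] at hb
    simp only [Real.norm_eq_abs] at hb
    rwa [← pow_succ, show r - (i + 1) + 1 = r - i by omega] at hb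

theorem eq_sum_taylor {r : ℕ} {P : ℝ[X]} (hP : P.natDegree < r) (x : ℝ) :
    P = ∑ i ∈ Finset.range r, C ((derivative^[i] P).eval x / i.factorial) * (X - C x) ^ i := by
  conv_lhs => rw [← sum_taylor_eq P x]
  rw [Polynomial.sum_over_range' _ (by simp) r (by rwa [natDegree_taylor])]
  refine Finset.sum_congr rfl fun i _ => ?_
  rw [iterate_derivative_eval_eq]
  congr 2
  field_simp

/-! ### Approximation error and lower bound for the Taylor coefficients. -/

/-- The coefficient sequence of the approximating polynomial. -/
noncomputable def taylorCoeff (f : ℝ → ℝ) (r m k : ℕ) : ℝ :=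
  bernsteinCoeff m k (unitTaylor f r ((k : ℝ) / m))

theorem div_mem_Icc {m k : ℕ} (hk : k ≤ m) : (k : ℝ) / m ∈ Icc (0 : ℝ) 1 :=
  ⟨by positivity, div_le_one_of_le₀ (by exact_mod_cast hk) (Nat.cast_nonneg m)⟩

/-- Both Taylor polynomials are expanded about the node `x`. The `i`-th terms differ by at most `M
|x-t|^(r-i)` times `(4r)^i Δ_m(x)^i`, and both powers are dominated by those of `s = Δ_m(t) +
|x-t|`. -/
theorem abs_taylorCoeff_sub_le {r m k : ℕ} (hr : 1 ≤ r) (hm : 2 * r ≤ m) (hk : k ≤ m)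
    {f : ℝ → ℝ} {M : ℝ} (hf : ContDiffOn ℝ (r : ℕ∞) f (Icc 0 1))
    (hM : ∀ x ∈ Icc (0 : ℝ) 1, |iteratedDerivWithin r f (Icc 0 1) x| ≤ M)
    {t : ℝ} (ht : t ∈ Icc (0 : ℝ) 1) :
    |taylorCoeff f r m k - bernsteinCoeff m k (unitTaylor f r t)| ≤
      r * M * (4 * r) ^ r * (2 ^ r * (bernsteinDelta m t ^ r + |(k : ℝ) / m - t| ^ r)) := by
  set x : ℝ := (k : ℝ) / m with hx
  have hxI : x ∈ Icc (0 : ℝ) 1 := div_mem_Icc hk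
  have hM0 : 0 ≤ M := (abs_nonneg _).trans (hM t ht)
  have hr' : (1 : ℝ) ≤ r := by exact_mod_cast hr
  have hd := bernsteinDelta_nonneg m t
  have hdx := bernsteinDelta_nonneg m x
  have ha := abs_nonneg (x - t)
  set s := bernsteinDelta m t + |x - t| with hs
  have hs0 : 0 ≤ s := by positivity
  have e : taylorCoeff f r m k - bernsteinCoeff m k (unitTaylor f r t) =
      ∑ i ∈ Finset.range r, (iteratedDerivWithin i f (Icc 0 1) x -
        (derivative^[i] (unitTaylor f r t)).eval x) / i.factorial *
        bernsteinCoeff m k ((X - C x) ^ i) := by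
    rw [taylorCoeff, ← hx]
    have hP := congrArg (bernsteinCoeff m k) (eq_sum_taylor (natDegree_unitTaylor_lt hr f t) x)
    rw [hP, unitTaylor, map_sum, map_sum, ← Finset.sum_sub_distrib]
    refine Finset.sum_congr rfl fun i _ => ?_
    rw [bernsteinCoeff_C_mul, bernsteinCoeff_C_mul]
    ring
  have hpow : s ^ r ≤ 2 ^ r * (bernsteinDelta m t ^ r + |x - t| ^ r) := by
    refine (add_pow_le hd ha r).trans ?_
    gcongr
    · exact one_le_two
    · omega
  rw [e]
  refine (Finset.abs_sum_le_sum_abs _ _).trans ?_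
  calc _ ≤ ∑ i ∈ Finset.range r, M * (4 * r : ℝ) ^ r * s ^ r := by
        refine Finset.sum_le_sum fun i hi => ?_
        have hir : i ≤ r := (Finset.mem_range.1 hi).le
        have h1 := abs_iteratedDerivWithin_sub_unitTaylor_le hr hf hM ht hir x hxI
        have h2 := abs_bernsteinCoeff_X_sub_C_pow_le hr hm hk hir
        rw [← hx] at h2
        have h3 : (1 : ℝ) ≤ i.factorial := by exact_mod_cast Nat.factorial_pos i
        rw [abs_mul, abs_div, abs_of_nonneg (zero_le_one.trans h3)]
        calc _ ≤ (M * |x - t| ^ (r - i)) * ((4 * r : ℝ) ^ i * bernsteinDelta m x ^ i) := by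
              gcongr
              exact (div_le_self (abs_nonneg _) h3).trans h1
          _ ≤ (M * s ^ (r - i)) * ((4 * r : ℝ) ^ r * s ^ i) := by
              gcongr
              · linarith
              · linarith
              · exact bernsteinDelta_le_add m ht x
          _ = M * (4 * r : ℝ) ^ r * (s ^ (r - i) * s ^ i) := by ring
          _ = _ := by rw [← pow_add, Nat.sub_add_cancel hir]
    _ = r * M * (4 * r : ℝ) ^ r * s ^ r := by
        rw [Finset.sum_const, Finset.card_range, nsmul_eq_mul]
        ring
    _ ≤ _ := by gcongr

/-- Approximation of order `Δ_m ^ r` by polynomials in Bernstein form. -/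
theorem abs_sub_sum_taylorCoeff_le {r m : ℕ} (hr : 1 ≤ r) (hm : 2 * r ≤ m)
    {f : ℝ → ℝ} {M : ℝ} (hf : ContDiffOn ℝ (r : ℕ∞) f (Icc 0 1))
    (hM : ∀ x ∈ Icc (0 : ℝ) 1, |iteratedDerivWithin r f (Icc 0 1) x| ≤ M)
    {t : ℝ} (ht : t ∈ Icc (0 : ℝ) 1) :
    |(∑ k ∈ Finset.range (m + 1), taylorCoeff f r m k * (bernsteinPolynomial ℝ m k).eval t) -
      f t| ≤ r * M * (8 * r) ^ r * (1 + 2 * Real.exp 1 * r.factorial) *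
        bernsteinDelta m t ^ r := by
  have hM0 : 0 ≤ M := (abs_nonneg _).trans (hM t ht)
  have hft : f t = ∑ k ∈ Finset.range (m + 1),
      bernsteinCoeff m k (unitTaylor f r t) * (bernsteinPolynomial ℝ m k).eval t := by
    rw [sum_bernsteinCoeff_mul_bernstein_eval (by
      have := natDegree_unitTaylor_lt hr f t
      omega)]
    have := iterate_derivative_unitTaylor_eval (i := 0) hr f t
    rw [iteratedDerivWithin_zero] at this
    exact this.symm
  rw [hft, ← Finset.sum_sub_distrib]
  refine (Finset.abs_sum_le_sum_abs _ _).trans ?_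
  calc _ ≤ ∑ k ∈ Finset.range (m + 1), (r * M * (8 * r) ^ r) *
        ((bernsteinPolynomial ℝ m k).eval t * bernsteinDelta m t ^ r +
          (bernsteinPolynomial ℝ m k).eval t * |(k : ℝ) / m - t| ^ r) := by
        refine Finset.sum_le_sum fun k hk => ?_
        have hb := bernstein_eval_nonneg m k ht
        have h := abs_taylorCoeff_sub_le hr hm (Nat.lt_succ_iff.1 (Finset.mem_range.1 hk)) hf hM ht
        rw [← sub_mul, abs_mul, abs_of_nonneg hb]
        refine (mul_le_mul_of_nonneg_right h hb).trans (le_of_eq ?_)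
        rw [show (8 * r : ℝ) = 4 * r * 2 by ring, mul_pow (4 * r : ℝ)]
        ring
    _ ≤ (r * M * (8 * r) ^ r) * (bernsteinDelta m t ^ r +
          2 * Real.exp 1 * r.factorial * bernsteinDelta m t ^ r) := by
        rw [← Finset.mul_sum, Finset.sum_add_distrib, ← Finset.sum_mul, sum_bernstein_eval, one_mul]
        gcongr
        exact sum_bernstein_mul_abs_sub_pow_le (by omega) ht r
    _ = _ := by ring

theorem sub_le_taylorCoeff {r m k : ℕ} (hr : 1 ≤ r) (hm : 2 * r ≤ m) (hk : k ≤ m)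
    {f : ℝ → ℝ} {δ : ℝ} {M : ℕ → ℝ} (hδ : ∀ t ∈ Icc (0 : ℝ) 1, δ ≤ f t)
    (hM : ∀ i : ℕ, 2 ≤ i → i ≤ r →
      ∀ t ∈ Icc (0 : ℝ) 1, |iteratedDerivWithin i f (Icc 0 1) t| ≤ M i) :
    δ - (∑ i ∈ Finset.range r, |M i|) * (4 * r) ^ r * (1 / Real.sqrt m) ≤
      taylorCoeff f r m k := by
  have hm1 : 1 ≤ m := by omega
  have hm0 : (0 : ℝ) < m := by exact_mod_cast hm1
  have hr' : (1 : ℝ) ≤ r := by exact_mod_cast hr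
  set x : ℝ := (k : ℝ) / m with hx
  have hxI : x ∈ Icc (0 : ℝ) 1 := div_mem_Icc hk
  have hs1 : 1 / Real.sqrt m ≤ 1 :=
    div_le_one_of_le₀ (Real.one_le_sqrt.2 (by exact_mod_cast hm1)) (Real.sqrt_nonneg _)
  obtain ⟨n, rfl⟩ : ∃ n, r = n + 1 := ⟨r - 1, by omega⟩
  have hb : ∀ i ∈ Finset.range n,
      |iteratedDerivWithin (i + 1) f (Icc 0 1) x / (i + 1).factorial *
        bernsteinCoeff m k ((X - C x) ^ (i + 1))| ≤
      |M (i + 1)| * ((4 * (n + 1 : ℕ)) ^ (n + 1) * (1 / Real.sqrt m)) := by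
    intro i hi
    have hin := Finset.mem_range.1 hi
    -- The index is shifted: `i = 0` is the first-derivative term, whose Bernstein coefficient
    -- vanishes, so `f'` needs no bound.
    rcases Nat.eq_zero_or_pos i with rfl | hi0
    · have h := bernsteinCoeff_X_sub_C_pow_succ hk (a := x) (by rw [hx]; field_simp) 0
      have h0 : bernsteinCoeff m k ((X - C x) ^ (0 + 1)) = 0 := by
        simpa [hm0.ne'] using h
      rw [h0, mul_zero, abs_zero]
      positivity
    · have h1 := hM (i + 1) (by omega) (by omega) x hxI
      have h2 := abs_bernsteinCoeff_X_sub_C_pow_le hr hm hk (i := i + 1) (by omega)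
      rw [← hx] at h2
      have h3 : (1 : ℝ) ≤ (i + 1).factorial := by exact_mod_cast Nat.factorial_pos _
      have h4 : bernsteinDelta m x ^ (i + 1) ≤ 1 / Real.sqrt m := by
        refine (pow_le_pow_left₀ (bernsteinDelta_nonneg m x) (bernsteinDelta_le hm1 hxI) _).trans ?_
        exact pow_le_of_le_one (by positivity) hs1 (by omega)
      rw [abs_mul, abs_div, abs_of_nonneg (zero_le_one.trans h3)]
      gcongr
      · exact (div_le_self (abs_nonneg _) h3).trans (h1.trans (le_abs_self _))
      · refine h2.trans ?_
        have := bernsteinDelta_nonneg m x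
        gcongr
        linarith
  have hsum : taylorCoeff f (n + 1) m k = (∑ i ∈ Finset.range n,
      iteratedDerivWithin (i + 1) f (Icc 0 1) x / (i + 1).factorial *
        bernsteinCoeff m k ((X - C x) ^ (i + 1))) + f x := by
    rw [taylorCoeff, ← hx, unitTaylor, map_sum, Finset.sum_range_succ']
    congr 1
    · simp only [bernsteinCoeff_C_mul]
    · rw [bernsteinCoeff_C_mul, pow_zero, bernsteinCoeff_one]
      simp
  have hS := (Finset.abs_sum_le_sum_abs _ _).trans (Finset.sum_le_sum hb)
  rw [← Finset.sum_mul] at hS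
  have hle : ∑ i ∈ Finset.range n, |M (i + 1)| ≤ ∑ i ∈ Finset.range (n + 1), |M i| := by
    rw [Finset.sum_range_succ']
    linarith [abs_nonneg (M 0)]
  have hS' := hS.trans (mul_le_mul_of_nonneg_right hle (by positivity))
  rw [hsum, mul_assoc]
  linarith [(abs_le.1 hS').1, hδ x hxI]

/-! ### Passage to mixtures and normalisation. -/

theorem bernsteinMixture_div (m : ℕ) (a : ℕ → ℝ) (t : ℝ) :
    bernsteinMixture m (fun i => a i / ((m : ℝ) + 1)) t =
      ∑ k ∈ Finset.range (m + 1), a k * (bernsteinPolynomial ℝ m k).eval t := by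
  rw [bernsteinMixture, ← Fin.sum_univ_eq_sum_range
    (fun k => a k * (bernsteinPolynomial ℝ m k).eval t)]
  refine Finset.sum_congr rfl fun i _ => ?_
  have : (m : ℝ) + 1 ≠ 0 := by positivity
  rw [betaDensity, bernstein_eval]
  field_simp

theorem bernsteinMixture_uniform (m : ℕ) (t : ℝ) :
    bernsteinMixture m (fun _ => 1 / ((m : ℝ) + 1)) t = 1 := by
  have := bernsteinMixture_div m (fun _ => 1) t
  simp only [one_mul] at this
  rw [this, sum_bernstein_eval]

theorem div_mem_stdSimplex {m : ℕ} {a : ℕ → ℝ} (h0 : ∀ k ≤ m, 0 ≤ a k)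
    (h1 : ∫ t in (0 : ℝ)..1, ∑ k ∈ Finset.range (m + 1),
      a k * (bernsteinPolynomial ℝ m k).eval t = 1) :
    (fun i : Fin (m + 1) => a i / ((m : ℝ) + 1)) ∈ stdSimplex ℝ (Fin (m + 1)) := by
  refine ⟨fun i => div_nonneg (h0 _ (Nat.lt_succ_iff.1 i.2)) (by positivity), ?_⟩
  rw [Fin.sum_univ_eq_sum_range (fun k => a k / ((m : ℝ) + 1)), ← Finset.sum_div,
    ← integral_sum_mul_bernstein, h1]

theorem uniform_mem_stdSimplex (m : ℕ) :
    (fun _ => 1 / ((m : ℝ) + 1)) ∈ stdSimplex ℝ (Fin (m + 1)) :=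
  div_mem_stdSimplex (a := fun _ => 1) (fun _ _ => zero_le_one) (by
    simp only [one_mul, sum_bernstein_eval]
    simp)

/-- Shows why the correction is a multiple of `(t(1-t))^r`: a constant of size `m^{-r/2}` would
exceed the order `Δ_m^r` near the endpoints. -/
theorem one_div_sqrt_pow_mul_le (m r : ℕ) {t : ℝ} (ht : t ∈ Icc (0 : ℝ) 1) :
    (1 / Real.sqrt m) ^ r * (t * (1 - t)) ^ r ≤ bernsteinDelta m t ^ r := by
  have h : 0 ≤ t * (1 - t) := mul_nonneg ht.1 (by linarith [ht.2])
  have h1 : t * (1 - t) ≤ 1 := by nlinarith [ht.1, ht.2]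
  rw [← mul_pow]
  refine pow_le_pow_left₀ (by positivity) ((?_ : _ ≤ _).trans (le_max_right _ _)) r
  rw [Real.sqrt_div h, div_mul_eq_mul_div, one_mul]
  gcongr
  exact Real.le_sqrt_self_iff.2 h1

theorem integral_mul_one_sub_pow_pos (r : ℕ) :
    0 < ∫ t in (0 : ℝ)..1, ((X * (1 - X)) ^ r : ℝ[X]).eval t := by
  refine intervalIntegral.intervalIntegral_pos_of_pos_on
    ((Polynomial.continuous _).intervalIntegrable _ _) (fun t ht => ?_) zero_lt_one
  have := ht.1
  have : 0 < 1 - t := by linarith [ht.2]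
  simp only [eval_pow, eval_mul, eval_X, eval_sub, eval_one]
  positivity

theorem abs_integral_sub_one_le {m r : ℕ} (hm : 1 ≤ m) {f F : ℝ → ℝ} {K : ℝ} (hK : 0 ≤ K)
    (hf : ContinuousOn f (Icc 0 1)) (hF : Continuous F) (hint : (∫ t in (0 : ℝ)..1, f t) = 1)
    (h : ∀ t ∈ Icc (0 : ℝ) 1, |F t - f t| ≤ K * bernsteinDelta m t ^ r) :
    |(∫ t in (0 : ℝ)..1, F t) - 1| ≤ K * (1 / Real.sqrt m) ^ r := by
  have hsub : (∫ t in (0 : ℝ)..1, F t) - 1 = ∫ t in (0 : ℝ)..1, (F t - f t) := by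
    rw [intervalIntegral.integral_sub (hF.intervalIntegrable _ _)
      (hf.intervalIntegrable_of_Icc zero_le_one), hint]
  rw [hsub]
  have := intervalIntegral.norm_integral_le_of_norm_le_const (a := 0) (b := 1)
    (f := fun t => F t - f t) (C := K * (1 / Real.sqrt m) ^ r) (fun t ht => by
      rw [uIoc_of_le zero_le_one] at ht
      have ht' : t ∈ Icc (0 : ℝ) 1 := Ioc_subset_Icc_self ht
      refine (h t ht').trans ?_
      gcongr
      · exact bernsteinDelta_nonneg m t
      · exact bernsteinDelta_le hm ht')
  simpa using this

theorem exists_mixture_of_large {r m : ℕ} (hr : 1 ≤ r) (hm : 2 * r ≤ m) {f : ℝ → ℝ}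
    {δ K E : ℝ} (hK : 0 ≤ K) (hf : ContinuousOn f (Icc 0 1))
    (hint : (∫ t in (0 : ℝ)..1, f t) = 1)
    (happrox : ∀ t ∈ Icc (0 : ℝ) 1, |(∑ k ∈ Finset.range (m + 1),
      taylorCoeff f r m k * (bernsteinPolynomial ℝ m k).eval t) - f t| ≤
        K * bernsteinDelta m t ^ r)
    (hcoeff : ∀ k ≤ m, δ - E * (1 / Real.sqrt m) ≤ taylorCoeff f r m k)
    (hlarge : (E + K / (∫ t in (0 : ℝ)..1, ((X * (1 - X)) ^ r : ℝ[X]).eval t) *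
      ∑ l ∈ ((X * (1 - X)) ^ r : ℝ[X]).support, |((X * (1 - X)) ^ r : ℝ[X]).coeff l|) *
        (1 / Real.sqrt m) ≤ δ) :
    ∃ p ∈ stdSimplex ℝ (Fin (m + 1)), ∀ t ∈ Icc (0 : ℝ) 1,
      |f t - bernsteinMixture m p t| ≤
        (K + K / (∫ t in (0 : ℝ)..1, ((X * (1 - X)) ^ r : ℝ[X]).eval t)) *
          bernsteinDelta m t ^ r := by
  set q : ℝ[X] := (X * (1 - X)) ^ r with hq
  set γ : ℝ := ∫ t in (0 : ℝ)..1, q.eval t with hγ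
  have hγ0 : 0 < γ := integral_mul_one_sub_pow_pos r
  set B : ℝ := ∑ l ∈ q.support, |q.coeff l| with hB
  have hm1 : 1 ≤ m := by omega
  have hdeg : q.natDegree ≤ m := by
    refine le_trans ?_ hm
    rw [hq, mul_comm 2 r]
    refine natDegree_pow_le.trans (Nat.mul_le_mul_left r ?_)
    compute_degree
  set F : ℝ → ℝ := fun t => ∑ k ∈ Finset.range (m + 1),
    taylorCoeff f r m k * (bernsteinPolynomial ℝ m k).eval t with hF
  have hFc : Continuous F := continuous_finsetSum _ fun k _ =>
    continuous_const.mul (Polynomial.continuous _)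
  set e : ℝ := (∫ t in (0 : ℝ)..1, F t) - 1 with he
  have hebound : |e| ≤ K * (1 / Real.sqrt m) ^ r :=
    abs_integral_sub_one_le hm1 hK hf hFc hint happrox
  -- Subtracting `(e/γ) q` restores integral 1; `hlarge` ensures that the coefficients stay
  -- nonnegative.
  set a : ℕ → ℝ := fun k => taylorCoeff f r m k - e / γ * bernsteinCoeff m k q with ha
  have hsum : ∀ t, ∑ k ∈ Finset.range (m + 1), a k * (bernsteinPolynomial ℝ m k).eval t =
      F t - e / γ * q.eval t := fun t => by
    rw [← sum_bernsteinCoeff_mul_bernstein_eval hdeg, Finset.mul_sum, ← Finset.sum_sub_distrib]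
    exact Finset.sum_congr rfl fun k _ => by ring
  have heγ : |e / γ| ≤ K / γ * (1 / Real.sqrt m) ^ r := by
    rw [abs_div, abs_of_pos hγ0, div_mul_eq_mul_div]
    gcongr
  have hs1 : 1 / Real.sqrt m ≤ 1 :=
    div_le_one_of_le₀ (Real.one_le_sqrt.2 (by exact_mod_cast hm1)) (Real.sqrt_nonneg _)
  refine ⟨fun i => a i / ((m : ℝ) + 1), div_mem_stdSimplex (fun k hk => ?_) ?_, fun t ht => ?_⟩
  · have h1 := hcoeff k hk
    have h2 : |e / γ * bernsteinCoeff m k q| ≤ K / γ * B * (1 / Real.sqrt m) := by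
      rw [abs_mul]
      calc _ ≤ K / γ * (1 / Real.sqrt m) ^ r * B := by
            gcongr
            exact abs_bernsteinCoeff_le hk q
        _ ≤ K / γ * (1 / Real.sqrt m) * B := by
            have : 0 ≤ B := Finset.sum_nonneg fun _ _ => abs_nonneg _
            gcongr
            exact pow_le_of_le_one (by positivity) hs1 (by omega)
        _ = _ := by ring
    simp only [ha]
    linarith [(abs_le.1 h2).2]
  · simp only [hsum]
    rw [intervalIntegral.integral_sub (hFc.intervalIntegrable _ _)
      (((Polynomial.continuous q).intervalIntegrable _ _).const_mul _),
      intervalIntegral.integral_const_mul, ← hγ, div_mul_cancel₀ _ hγ0.ne', he]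
    ring
  · rw [bernsteinMixture_div, hsum]
    have hqt : q.eval t = (t * (1 - t)) ^ r := by simp [hq]
    have hq0 : 0 ≤ q.eval t := by
      rw [hqt]
      exact pow_nonneg (mul_nonneg ht.1 (by linarith [ht.2])) r
    calc |f t - (F t - e / γ * q.eval t)| = |-(F t - f t) + e / γ * q.eval t| := by
          congr 1
          ring
      _ ≤ |F t - f t| + |e / γ| * q.eval t := by
          refine (abs_add_le _ _).trans (le_of_eq ?_)
          rw [abs_neg, abs_mul, abs_of_nonneg hq0]
      _ ≤ K * bernsteinDelta m t ^ r + K / γ * (1 / Real.sqrt m) ^ r * q.eval t := by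
          gcongr
          exact happrox t ht
      _ = K * bernsteinDelta m t ^ r +
          K / γ * ((1 / Real.sqrt m) ^ r * (t * (1 - t)) ^ r) := by
          rw [hqt]
          ring
      _ ≤ K * bernsteinDelta m t ^ r + K / γ * bernsteinDelta m t ^ r := by
          gcongr
          exact one_div_sqrt_pow_mul_le m r ht
      _ = _ := by ring

/-! ### Small `m` and assembly. -/

/-- For `m ≤ m₀`, `m₀ Δ_m ≥ 1`, so a bounded error is already of the required order; for `r = 0`
this is trivial. -/
theorem abs_sub_uniform_le {r m m₀ : ℕ} (hm : 1 ≤ m) (hmm : r = 0 ∨ m ≤ m₀) {y A : ℝ}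
    (hy : |y| ≤ A) (t : ℝ) : |y - 1| ≤ (A + 1) * m₀ ^ r * bernsteinDelta m t ^ r := by
  have hm0 : (0 : ℝ) < m := by exact_mod_cast hm
  have h1 : |y - 1| ≤ A + 1 := by
    refine (abs_sub _ _).trans ?_
    rw [abs_one]
    linarith
  have hA : 0 ≤ A + 1 := (abs_nonneg _).trans h1
  have h2 : (1 : ℝ) ≤ m₀ ^ r * bernsteinDelta m t ^ r := by
    rcases hmm with rfl | hmm
    · simp
    · rw [← mul_pow]
      apply one_le_pow₀
      calc (1 : ℝ) = m * (1 / m) := by field_simp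
        _ ≤ m₀ * bernsteinDelta m t := by
          gcongr
          exact one_div_le_bernsteinDelta m t
  rw [mul_assoc]
  exact h1.trans (le_mul_of_one_le_right hA h2)

theorem theorem1 (r : ℕ) (δ : ℝ) (hδ : 0 < δ) (M : ℕ → ℝ) :
    ∃ C : ℝ, ∀ f : ℝ → ℝ,
      ContDiffOn ℝ (r : ℕ∞) f (Icc 0 1) →
      (∫ t in (0 : ℝ)..1, f t) = 1 →
      (∀ t ∈ Icc (0 : ℝ) 1, δ ≤ f t) →
      (∀ t ∈ Icc (0 : ℝ) 1, |f t| ≤ M 0) →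
      (∀ i : ℕ, (2 ≤ i ∧ i ≤ r) ∨ i = r →
        ∀ t ∈ Icc (0 : ℝ) 1, |iteratedDerivWithin i f (Icc 0 1) t| ≤ M i) →
      ∃ p : (m : ℕ) → Fin (m + 1) → ℝ,
        ∀ m : ℕ, 1 ≤ m →
          p m ∈ stdSimplex ℝ (Fin (m + 1)) ∧
          ∀ t ∈ Icc (0 : ℝ) 1,
            |f t - bernsteinMixture m (p m) t| ≤ C * bernsteinDelta m t ^ r := by

  set γ : ℝ := ∫ t in (0 : ℝ)..1, ((X * (1 - X)) ^ r : ℝ[X]).eval t with hγ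
  set B : ℝ := ∑ l ∈ ((X * (1 - X)) ^ r : ℝ[X]).support, |((X * (1 - X)) ^ r : ℝ[X]).coeff l|
    with hB
  have hγ0 : 0 < γ := integral_mul_one_sub_pow_pos r
  set K : ℝ := r * |M r| * (8 * r) ^ r * (1 + 2 * Real.exp 1 * r.factorial) with hK
  set E : ℝ := (∑ i ∈ Finset.range r, |M i|) * (4 * r) ^ r with hE
  have hK0 : 0 ≤ K := by positivity
  have hlim : Filter.Tendsto (fun m : ℕ => (E + K / γ * B) * (1 / Real.sqrt m)) Filter.atTop
      (nhds 0) := by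
    have h := (tendsto_inv_atTop_zero.comp
      (Real.tendsto_sqrt_atTop.comp (tendsto_natCast_atTop_atTop (R := ℝ)))).const_mul
        (E + K / γ * B)
    simpa [Function.comp_def] using h
  -- The threshold depends only on `r`, `δ` and `M`, being fixed before `f`.
  obtain ⟨m₁, hm₁⟩ := Filter.eventually_atTop.1 (hlim.eventually_le_const hδ)
  set m₀ := max m₁ (2 * r) with hm₀
  refine ⟨(K + K / γ) + (|M 0| + 1) * m₀ ^ r, fun f hf hint hlow hup hder => ?_⟩
  have hmain : ∀ m : ℕ, ∃ p : Fin (m + 1) → ℝ, 1 ≤ m → p ∈ stdSimplex ℝ (Fin (m + 1)) ∧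
      ∀ t ∈ Icc (0 : ℝ) 1, |f t - bernsteinMixture m p t| ≤
        ((K + K / γ) + (|M 0| + 1) * m₀ ^ r) * bernsteinDelta m t ^ r := fun m => by
    have hD := fun t => pow_nonneg (bernsteinDelta_nonneg m t) r
    by_cases hmm : r = 0 ∨ m ≤ m₀
    · refine ⟨fun _ => 1 / ((m : ℝ) + 1), fun hm => ⟨uniform_mem_stdSimplex m, fun t ht => ?_⟩⟩
      rw [bernsteinMixture_uniform]
      refine (abs_sub_uniform_le hm hmm ((hup t ht).trans (le_abs_self _)) t).trans ?_
      refine mul_le_mul_of_nonneg_right ?_ (hD t)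
      have : 0 ≤ K + K / γ := by positivity
      linarith
    · obtain ⟨hr0, hlt⟩ := not_or.1 hmm
      have hr : 1 ≤ r := Nat.one_le_iff_ne_zero.2 hr0
      have h2r : 2 * r ≤ m := (le_max_right _ _).trans (not_le.1 hlt).le
      obtain ⟨p, hp, hpt⟩ := exists_mixture_of_large hr h2r hK0 hf.continuousOn hint
        (fun t ht => abs_sub_sum_taylorCoeff_le hr h2r hf
          (fun x hx => (hder r (Or.inr rfl) x hx).trans (le_abs_self _)) ht)
        (fun k hk => sub_le_taylorCoeff hr h2r hk hlow
          fun i h2 hi => hder i (Or.inl ⟨h2, hi⟩))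
        (hm₁ m ((le_max_left _ _).trans (not_le.1 hlt).le))
      refine ⟨p, fun _ => ⟨hp, fun t ht => (hpt t ht).trans ?_⟩⟩
      refine mul_le_mul_of_nonneg_right ?_ (hD t)
      have : 0 ≤ (|M 0| + 1) * (m₀ : ℝ) ^ r := by positivity
      linarith
  choose p hp using hmain
  exact ⟨p, hp⟩
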